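/- There is an absolute constant $C>0$ with the following property. Let $n\ge 1$, let $\Omega\subset\mathbf R^n$ be an open set, and let $V:\mathbf R^n\to\mathbf R$ be bounded and continuous with $V(x)\ge 0$ for all $x\in\mathbf R^n$ and $V(x)>0$ for all $x\in\Omega$. All functions are real-valued, and $\|\cdot\|$ and $(\cdot,\cdot)$ denote the norm and inner product of $L^2(\mathbf R^n)$. Let $(u_0,u_1)\in H^1(\mathbf R^n)\times L^2(\mathbf R^n)$ with $\operatorname{supp}u_1\subset\Omega$ and $$J_0^2:=\int_\Omega\frac{|u_1(x)|^2}{V(x)}\,dx<+\infty ,\qquad J_0\ge 0.$$ Let $u\in C([0,\infty);H^1(\mathbf R^n))\cap C^1([0,\infty);L^2(\mathbf R^n))$ be the (unique) weak solution of the Cauchy problem $$u_{tt}-\Delta u+V(x)u=0\quad (t>0,\ x\in\mathbf R^n),\qquad u(0,x)=u_0(x),\quad u_t(0,x)=u_1(x),$$ that is, $u(0)=u_0$, $u_t(0)=u_1$, and for every $\varphi\in H^1(\mathbf R^n)$ and every $t\ge0$ $$\frac{d}{dt}(u_t(t),\varphi)+(\nabla u(t),\nabla\varphi)+\int_{\mathbf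 R^n}V(x)\,u(t,x)\,\varphi(x)\,dx=0 .$$ Then $$\|u(t,\cdot)\|\le C\,(\|u_0\|+J_0)\qquad\text{for all } t\ge 0 .$$ -/

import Mathlib

open MeasureTheory Set Filter Topology
open scoped ContDiff ENNReal BoundedContinuousFunction InnerProductSpace

namespace WaveEq

/-- Euclidean space `ℝⁿ`. -/
abbrev Rn (n : ℕ) : Type := EuclideanSpace ℝ (Fin n)

/-- The real Hilbert space `L²(ℝⁿ)`. -/
abbrev L2 (n : ℕ) : Type := Lp ℝ 2 (volume : Measure (Rn n))

/-- The real Hilbert space `L²(ℝⁿ; ℝⁿ)` of square integrable vector fields. -/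
abbrev L2Vec (n : ℕ) : Type := Lp (Rn n) 2 (volume : Measure (Rn n))

/-- `G` is the weak gradient of `f`: for every test function `φ ∈ C_c^∞(ℝⁿ)` and every `i`,
`∫ f ∂ᵢφ dx = - ∫ Gᵢ φ dx`. -/
def IsWeakGradient {n : ℕ} (f : L2 n) (G : L2Vec n) : Prop :=
  ∀ φ : Rn n → ℝ, ContDiff ℝ ∞ φ → HasCompactSupport φ → ∀ i : Fin n,
    ∫ x, f x * fderiv ℝ φ x (EuclideanSpace.single i 1) = -∫ x, G x i * φ x

theorem integrable_mul_partial {n : ℕ} (f : L2 n) {φ : Rn n → ℝ} (hφ : ContDiff ℝ ∞ φ)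
    (hc : HasCompactSupport φ) (v : Rn n) :
    Integrable (fun x => f x * fderiv ℝ φ x v) := by
  have h1 : Continuous fun x => fderiv ℝ φ x v :=
    (hφ.continuous_fderiv (by simp)).clm_apply continuous_const
  have h2 : HasCompactSupport fun x => fderiv ℝ φ x v := hc.fderiv_apply ℝ v
  exact (Lp.memLp f).integrable_mul (h1.memLp_of_hasCompactSupport (p := 2) h2)

theorem integrable_coord_mul {n : ℕ} (G : L2Vec n) {φ : Rn n → ℝ} (hφ : ContDiff ℝ ∞ φ)
    (hc : HasCompactSupport φ) (i : Fin n) :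
    Integrable (fun x => G x i * φ x) := by
  have h := (EuclideanSpace.proj i : Rn n →L[ℝ] ℝ).comp_memLp' (Lp.memLp G)
  exact h.integrable_mul (hφ.continuous.memLp_of_hasCompactSupport (p := 2) hc)

theorem IsWeakGradient.zero {n : ℕ} : IsWeakGradient (0 : L2 n) 0 := by
  intro φ _ _ i
  have h1 : (fun x => (0 : L2 n) x * fderiv ℝ φ x (EuclideanSpace.single i 1))
      =ᵐ[volume] fun _ => 0 := by
    filter_upwards [Lp.coeFn_zero ℝ 2 (volume : Measure (Rn n))] with x hx
    rw [hx]
    simp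
  have h2 : (fun x => (0 : L2Vec n) x i * φ x) =ᵐ[volume] fun _ => 0 := by
    filter_upwards [Lp.coeFn_zero (Rn n) 2 (volume : Measure (Rn n))] with x hx
    rw [hx]
    simp
  rw [integral_congr_ae h1, integral_congr_ae h2]
  simp

theorem IsWeakGradient.add {n : ℕ} {f g : L2 n} {F G : L2Vec n} (hf : IsWeakGradient f F)
    (hg : IsWeakGradient g G) : IsWeakGradient (f + g) (F + G) := by
  intro φ hφ hc i
  have h1 : (fun x => (f + g) x * fderiv ℝ φ x (EuclideanSpace.single i 1)) =ᵐ[volume]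
      fun x => f x * fderiv ℝ φ x (EuclideanSpace.single i 1) +
        g x * fderiv ℝ φ x (EuclideanSpace.single i 1) := by
    filter_upwards [Lp.coeFn_add f g] with x hx
    rw [hx]
    simp [add_mul]
  have h2 : (fun x => (F + G) x i * φ x) =ᵐ[volume] fun x => F x i * φ x + G x i * φ x := by
    filter_upwards [Lp.coeFn_add F G] with x hx
    rw [hx]
    simp [add_mul]
  rw [integral_congr_ae h1, integral_congr_ae h2,
    integral_add (integrable_mul_partial f hφ hc _) (integrable_mul_partial g hφ hc _),
    integral_add (integrable_coord_mul F hφ hc i) (integrable_coord_mul G hφ hc i),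
    hf φ hφ hc i, hg φ hφ hc i]
  ring

theorem IsWeakGradient.smul {n : ℕ} {f : L2 n} {F : L2Vec n} (c : ℝ)
    (hf : IsWeakGradient f F) : IsWeakGradient (c • f) (c • F) := by
  intro φ hφ hc i
  have h1 : (fun x => (c • f) x * fderiv ℝ φ x (EuclideanSpace.single i 1)) =ᵐ[volume]
      fun x => c * (f x * fderiv ℝ φ x (EuclideanSpace.single i 1)) := by
    filter_upwards [Lp.coeFn_smul c f] with x hx
    rw [hx]
    simp [mul_assoc]
  have h2 : (fun x => (c • F) x i * φ x) =ᵐ[volume] fun x => c * (F x i * φ x) := by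
    filter_upwards [Lp.coeFn_smul c F] with x hx
    rw [hx]
    simp [mul_assoc]
  rw [integral_congr_ae h1, integral_congr_ae h2, integral_const_mul, integral_const_mul,
    hf φ hφ hc i]
  ring

/-- The Sobolev space `H¹(ℝⁿ)`: the functions `f ∈ L²(ℝⁿ)` that have a weak gradient
`∇f ∈ L²(ℝⁿ; ℝⁿ)`, realized as the space of pairs `(f, ∇f)` (the weak gradient is determined by
`f`), with the Hilbert norm `‖f‖²_{H¹} = ‖f‖² + ‖∇f‖²` of the `ℓ²`-product. -/
def H1 (n : ℕ) : Submodule ℝ (WithLp 2 (L2 n × L2Vec n)) where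
  carrier := {p | IsWeakGradient p.fst p.snd}
  add_mem' := fun hp hq => hp.add hq
  zero_mem' := IsWeakGradient.zero
  smul_mem' := fun c _ hp => hp.smul c

/-- The `L²`-function underlying an element of `H¹(ℝⁿ)`. -/
def toL2 {n : ℕ} (f : H1 n) : L2 n := f.1.fst

/-- The weak gradient of an element of `H¹(ℝⁿ)`. -/
def weakGrad {n : ℕ} (f : H1 n) : L2Vec n := f.1.snd

/-- The (closed) support of the class `f ∈ L²(ℝⁿ)`: the points no neighbourhood of which is a
set where `f` vanishes almost everywhere. -/
def essSupport {n : ℕ} (f : L2 n) : Set (Rn n) :=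
  {x | ∀ U ∈ 𝓝 x, ¬ ∀ᵐ y ∂(volume.restrict U), f y = 0}

/-- `u ∈ C([0,∞); H¹(ℝⁿ)) ∩ C¹([0,∞); L²(ℝⁿ))` is a weak solution of
`u_tt - Δu + V u = 0`, `u(0) = u₀`, `u_t(0) = u₁`: there is a time derivative
`u_t ∈ C([0,∞); L²(ℝⁿ))` (one-sided at `t = 0`) and, for every `φ ∈ H¹(ℝⁿ)` and `t ≥ 0`,
`d/dt (u_t, φ) + (∇u, ∇φ) + ∫ V u φ dx = 0`. Only the values `u t` with `t ≥ 0` matter. -/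
def IsWeakSolution {n : ℕ} (V : Rn n →ᵇ ℝ) (u₀ : H1 n) (u₁ : L2 n) (u : ℝ → H1 n) : Prop :=
  ContinuousOn u (Ici 0) ∧ u 0 = u₀ ∧
  ∃ ut : ℝ → L2 n, ContinuousOn ut (Ici 0) ∧ ut 0 = u₁ ∧
    (∀ t : ℝ, 0 ≤ t → HasDerivWithinAt (fun s => toL2 (u s)) (ut t) (Ici 0) t) ∧
    ∀ φ : H1 n, ∀ t : ℝ, 0 ≤ t →
      HasDerivWithinAt (fun s => ⟪ut s, toL2 φ⟫_ℝ)
        (-(⟪weakGrad (u t), weakGrad φ⟫_ℝ + ∫ x, V x * toL2 (u t) x * toL2 φ x)) (Ici 0) t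

end WaveEq

/-! The time primitive `w(t) = ∫₀ᵗ u ds` solves `w_tt - Δw + V w = u₁` with `w(0) = 0`, so testing
with `w_t = u` gives `‖u‖² + ‖∇w‖² + ∫ V w² = ‖u₀‖² + 2 (u₁, w)`. Since `u₁` lives where `V > 0`,
Young's inequality `2 u₁ w ≤ u₁² / V + V w²` lets the potential energy absorb the source term, which
leaves `‖u‖² ≤ ‖u₀‖² + J₀²`. -/

namespace WaveEq

theorem le_add_sqrt_of_sq_le {a b c : ℝ} (ha : 0 ≤ a) (h : c ^ 2 ≤ a ^ 2 + b) : c ≤ a + √b := by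
  have hb : b ≤ √b ^ 2 := (Real.sqrt_le_iff.1 le_rfl).2
  refine le_of_abs_le (abs_le_of_sq_le_sq ?_ (by positivity))
  nlinarith [mul_nonneg ha (Real.sqrt_nonneg b)]

section HalfLine

variable {E : Type*} [NormedAddCommGroup E] [NormedSpace ℝ E] {f : ℝ → E} {a : ℝ}

theorem exists_hasDerivWithinAt_Ici_of_continuousOn [CompleteSpace E]
    (hf : ContinuousOn f (Ici a)) :
    ∃ F : ℝ → E, F a = 0 ∧ ∀ t, a ≤ t → HasDerivWithinAt F (f t) (Ici a) t := by
  have hc : Continuous fun s => f (max s a) :=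
    hf.comp_continuous (continuous_id.max continuous_const) fun s => le_max_right s a
  refine ⟨fun t => ∫ s in a..t, f (max s a), intervalIntegral.integral_same, fun t ht => ?_⟩
  have := (hc.integral_hasStrictDerivAt a t).hasDerivAt.hasDerivWithinAt (s := Ici a)
  rwa [max_eq_left ht] at this

theorem eq_of_hasDerivWithinAt_Ici_zero
    (hf : ∀ t, a ≤ t → HasDerivWithinAt f 0 (Ici a) t) {t : ℝ} (ht : a ≤ t) : f t = f a :=
  constant_of_has_deriv_right_zero
    (fun s hs => (hf s hs.1).continuousWithinAt.mono Icc_subset_Ici_self)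
    (fun s hs => (hf s hs.1).mono (Ici_subset_Ici.2 hs.1)) t ⟨ht, le_rfl⟩

end HalfLine

section AbstractWaveEquation

variable {E H : Type*} [NormedAddCommGroup E] [NormedSpace ℝ E] [NormedAddCommGroup H]
  [InnerProductSpace ℝ H] {ι : E →L[ℝ] H} {B : E →L[ℝ] E →L[ℝ] ℝ} {u w : ℝ → E} {v : ℝ → H}

theorem inner_add_primitive_eq (hw₀ : w 0 = 0)
    (hw : ∀ t, 0 ≤ t → HasDerivWithinAt w (u t) (Ici 0) t) {φ : E}
    (hweak : ∀ t, 0 ≤ t → HasDerivWithinAt (fun s => ⟪v s, ι φ⟫_ℝ) (-B (u t) φ) (Ici 0) t)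
    {t : ℝ} (ht : 0 ≤ t) : ⟪v t, ι φ⟫_ℝ + B (w t) φ = ⟪v 0, ι φ⟫_ℝ := by
  have hB : ∀ s, 0 ≤ s → HasDerivWithinAt (fun s => B (w s) φ) (B (u s) φ) (Ici 0) s :=
    fun s hs => (B.flip φ).hasFDerivAt.comp_hasDerivWithinAt s (hw s hs)
  have hconst := eq_of_hasDerivWithinAt_Ici_zero
    (fun s hs => ((hweak s hs).add (hB s hs)).congr_deriv (neg_add_cancel _)) ht
  simpa [hw₀] using hconst

theorem norm_sq_add_primitive_energy_eq (hB : ∀ x y, B x y = B y x) (hw₀ : w 0 = 0)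
    (hw : ∀ t, 0 ≤ t → HasDerivWithinAt w (u t) (Ici 0) t)
    (hv : ∀ t, 0 ≤ t → HasDerivWithinAt (fun s => ι (u s)) (v t) (Ici 0) t)
    (hweak : ∀ r, 0 ≤ r → ∀ t, 0 ≤ t →
      HasDerivWithinAt (fun s => ⟪v s, ι (u r)⟫_ℝ) (-B (u t) (u r)) (Ici 0) t)
    {t : ℝ} (ht : 0 ≤ t) :
    ‖ι (u t)‖ ^ 2 + B (w t) (w t) = ‖ι (u 0)‖ ^ 2 + 2 * ⟪v 0, ι (w t)⟫_ℝ := by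
  have henergy : ∀ s, 0 ≤ s → HasDerivWithinAt
      (fun s => ‖ι (u s)‖ ^ 2 + B (w s) (w s) - 2 * ⟪v 0, ι (w s)⟫_ℝ) 0 (Ici 0) s := by
    intro s hs
    have hsource : HasDerivWithinAt (fun s => ⟪v 0, ι (w s)⟫_ℝ) ⟪v 0, ι (u s)⟫_ℝ (Ici 0) s :=
      ((innerSL ℝ (v 0)).comp ι).hasFDerivAt.comp_hasDerivWithinAt s (hw s hs)
    refine (((hv s hs).norm_sq.add (B.hasDerivWithinAt_of_bilinear (hw s hs) (hw s hs))).sub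
      (hsource.const_mul 2)).congr_deriv ?_
    linarith [inner_add_primitive_eq hw₀ hw (hweak s hs) hs, hB (u s) (w s),
      real_inner_comm (v s) (ι (u s))]
  have hconst := eq_of_hasDerivWithinAt_Ici_zero henergy ht
  simp only [hw₀, map_zero, inner_zero_right, mul_zero, add_zero, sub_zero] at hconst
  linarith

end AbstractWaveEquation

section Weighted

variable {α : Type*} [MeasurableSpace α] {μ : Measure α}

/-- The weighted pairing `(f, g) ↦ ∫ V f g dμ` on `L²(μ)` for a weight `V ∈ L^∞(μ)`, as a
continuous bilinear form; it carries the potential term of the wave equation. -/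
noncomputable def weightedForm {V : α → ℝ} (hV : MemLp V ∞ μ) : Lp ℝ 2 μ →L[ℝ] Lp ℝ 2 μ →L[ℝ] ℝ :=
  (ContinuousLinearMap.mul ℝ ℝ).lpPairing μ 2 2 ∘L
    (ContinuousLinearMap.mul ℝ ℝ).holderL μ ∞ 2 2 hV.toLp

theorem weightedForm_apply {V : α → ℝ} (hV : MemLp V ∞ μ) (f g : Lp ℝ 2 μ) :
    weightedForm hV f g = ∫ x, V x * f x * g x ∂μ := by
  rw [weightedForm, ContinuousLinearMap.comp_apply, ContinuousLinearMap.lpPairing_eq_integral]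
  refine integral_congr_ae ?_
  filter_upwards [(ContinuousLinearMap.mul ℝ ℝ).coeFn_holder (r := 2) hV.toLp f,
    hV.coeFn_toLp] with x hx hVx
  simp only [ContinuousLinearMap.holderL_apply_apply, hx, hVx, ContinuousLinearMap.mul_apply']

theorem weightedForm_comm {V : α → ℝ} (hV : MemLp V ∞ μ) (f g : Lp ℝ 2 μ) :
    weightedForm hV f g = weightedForm hV g f := by
  simp only [weightedForm_apply, mul_right_comm]

theorem two_mul_integral_mul_le {V f g : α → ℝ} {S : Set α} (hS : MeasurableSet S)
    (hpos : ∀ x ∈ S, 0 < V x) (hnn : ∀ x, 0 ≤ V x) (hf : ∀ᵐ x ∂μ, x ∉ S → f x = 0)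
    (hfg : Integrable (fun x => f x * g x) μ)
    (hfV : IntegrableOn (fun x => |f x| ^ 2 / V x) S μ)
    (hVg : Integrable (fun x => V x * g x * g x) μ) :
    2 * ∫ x, f x * g x ∂μ ≤ ∫ x in S, |f x| ^ 2 / V x ∂μ + ∫ x, V x * g x * g x ∂μ := by
  have hind := (integrable_indicator_iff hS).2 hfV
  rw [← integral_const_mul, ← integral_indicator hS, ← integral_add hind hVg]
  refine integral_mono_ae (hfg.const_mul 2) (hind.add hVg) ?_
  filter_upwards [hf] with x hfx
  by_cases hx : x ∈ S
  · simp only [indicator_of_mem hx, sq_abs]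
    calc 2 * (f x * g x) = 2 * g x * f x := by ring
      _ ≤ V x * g x ^ 2 + (V x)⁻¹ * f x ^ 2 := two_mul_le_add_mul_sq (hpos x hx)
      _ = f x ^ 2 / V x + V x * g x * g x := by ring
  · simpa only [hfx hx, indicator_of_notMem hx, zero_mul, mul_zero, zero_add, mul_assoc]
      using mul_nonneg (hnn x) (mul_self_nonneg (g x))

end Weighted

section Support

variable {n : ℕ}

theorem essSupport_eq_support_restrict (f : L2 n) :
    essSupport f = ((volume : Measure (Rn n)).restrict (Function.support f)).support := by
  have hmeas : MeasurableSet (Function.support f) :=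
    (Lp.stronglyMeasurable f).measurableSet_support
  ext x
  rw [Measure.mem_support_iff_forall]
  refine forall₂_congr fun U _ => ?_
  rw [pos_iff_ne_zero, Measure.restrict_apply' hmeas, inter_comm, ← Measure.restrict_apply hmeas]
  rfl

theorem measurableSet_essSupport (f : L2 n) : MeasurableSet (essSupport f) :=
  essSupport_eq_support_restrict f ▸ Measure.isClosed_support.measurableSet

theorem ae_eq_zero_of_notMem_essSupport (f : L2 n) : ∀ᵐ x, x ∉ essSupport f → f x = 0 := by
  have hsupp : ∀ᵐ x ∂volume.restrict (Function.support f), x ∈ essSupport f := by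
    rw [essSupport_eq_support_restrict]
    exact Measure.support_mem_ae
  filter_upwards [(ae_restrict_iff' (Lp.stronglyMeasurable f).measurableSet_support).1 hsupp]
    with x hx
  exact not_imp_comm.1 hx

theorem two_mul_inner_le {Ω : Set (Rn n)} {V : Rn n →ᵇ ℝ} (hpos : ∀ x ∈ Ω, 0 < V x)
    (hnn : ∀ x, 0 ≤ V x) {f : L2 n} (hf : essSupport f ⊆ Ω)
    (hint : IntegrableOn (fun x => |f x| ^ 2 / V x) Ω) (g : L2 n) :
    2 * ⟪f, g⟫_ℝ ≤ (∫ x in Ω, |f x| ^ 2 / V x) + weightedForm V.memLp_top g g := by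
  have hinner : ⟪f, g⟫_ℝ = ∫ x, f x * g x := by
    simp only [L2.inner_def, RCLike.inner_apply, conj_trivial, mul_comm]
  have hVg : Integrable (fun x => V x * g x * g x) :=
    ((Lp.memLp g).mul V.memLp_top (r := 2)).integrable_mul (Lp.memLp g)
  calc 2 * ⟪f, g⟫_ℝ
      ≤ (∫ x in essSupport f, |f x| ^ 2 / V x) + weightedForm V.memLp_top g g := by
        rw [hinner, weightedForm_apply]
        exact two_mul_integral_mul_le (measurableSet_essSupport f) (fun x hx => hpos x (hf hx))
          hnn (ae_eq_zero_of_notMem_essSupport f) ((Lp.memLp f).integrable_mul (Lp.memLp g))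
          (hint.mono_set hf) hVg
    _ ≤ (∫ x in Ω, |f x| ^ 2 / V x) + weightedForm V.memLp_top g g := by
        have hdensity : ∀ x, 0 ≤ |f x| ^ 2 / V x := fun x => div_nonneg (sq_nonneg _) (hnn x)
        exact add_le_add_left
          (setIntegral_mono_set hint (Eventually.of_forall hdensity) hf.eventuallyLE) _

end Support

section EnergyForm

variable {n : ℕ}

/-- The bilinear form `(∇f, ∇g) + ∫ V f g dx` of the operator `-Δ + V`. It is defined on the whole
Hilbert space of pairs `(f, F)` containing `H1 n`, with `F` in the place of `∇f`, because that space
is complete. -/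
noncomputable def energyForm (V : Rn n →ᵇ ℝ) :
    WithLp 2 (L2 n × L2Vec n) →L[ℝ] WithLp 2 (L2 n × L2Vec n) →L[ℝ] ℝ :=
  (isBoundedBilinearMap_inner (𝕜 := ℝ)).toContinuousLinearMap.bilinearComp
      (WithLp.sndL 2 ℝ (L2 n) (L2Vec n)) (WithLp.sndL 2 ℝ (L2 n) (L2Vec n)) +
    (weightedForm V.memLp_top).bilinearComp
      (WithLp.fstL 2 ℝ (L2 n) (L2Vec n)) (WithLp.fstL 2 ℝ (L2 n) (L2Vec n))

theorem energyForm_apply (V : Rn n →ᵇ ℝ) (p q : WithLp 2 (L2 n × L2Vec n)) :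
    energyForm V p q = ⟪p.snd, q.snd⟫_ℝ + weightedForm V.memLp_top p.fst q.fst :=
  rfl

theorem energyForm_comm (V : Rn n →ᵇ ℝ) (p q : WithLp 2 (L2 n × L2Vec n)) :
    energyForm V p q = energyForm V q p := by
  rw [energyForm_apply, energyForm_apply, real_inner_comm, weightedForm_comm]

theorem weightedForm_fst_le_energyForm (V : Rn n →ᵇ ℝ) (p : WithLp 2 (L2 n × L2Vec n)) :
    weightedForm V.memLp_top p.fst p.fst ≤ energyForm V p p := by
  rw [energyForm_apply]
  exact le_add_of_nonneg_left real_inner_self_nonneg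

theorem IsWeakSolution.exists_norm_sq_add_energyForm_eq {V : Rn n →ᵇ ℝ} {u₀ : H1 n} {u₁ : L2 n}
    {u : ℝ → H1 n} (hu : IsWeakSolution V u₀ u₁ u) :
    ∃ w : ℝ → WithLp 2 (L2 n × L2Vec n), ∀ t, 0 ≤ t →
      ‖toL2 (u t)‖ ^ 2 + energyForm V (w t) (w t) = ‖toL2 u₀‖ ^ 2 + 2 * ⟪u₁, (w t).fst⟫_ℝ := by
  obtain ⟨hcont, rfl, ut, -, rfl, hder, hweak⟩ := hu
  obtain ⟨w, hw₀, hw⟩ := exists_hasDerivWithinAt_Ici_of_continuousOn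
    (continuous_subtype_val.comp_continuousOn hcont)
  refine ⟨w, fun t ht => norm_sq_add_primitive_energy_eq (ι := WithLp.fstL 2 ℝ (L2 n) (L2Vec n))
    (energyForm_comm V) hw₀ hw hder (fun r _ s hs => ?_) ht⟩
  refine (hweak (u r) s hs).congr_deriv ?_
  rw [energyForm_apply, weightedForm_apply]
  rfl

end EnergyForm

end WaveEq

theorem theorem1p2_general {n : ℕ} {Ω : Set (WaveEq.Rn n)} {V : WaveEq.Rn n →ᵇ ℝ}
    (hpos : ∀ x ∈ Ω, 0 < V x) (hnn : ∀ x, 0 ≤ V x) {u₀ : WaveEq.H1 n} {u₁ : WaveEq.L2 n}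
    (hsupp : WaveEq.essSupport u₁ ⊆ Ω) (hint : IntegrableOn (fun x => |u₁ x| ^ 2 / V x) Ω)
    {u : ℝ → WaveEq.H1 n} (hu : WaveEq.IsWeakSolution V u₀ u₁ u) {t : ℝ} (ht : 0 ≤ t) :
    ‖WaveEq.toL2 (u t)‖ ^ 2 ≤ ‖WaveEq.toL2 u₀‖ ^ 2 + ∫ x in Ω, |u₁ x| ^ 2 / V x := by
  obtain ⟨w, hw⟩ := hu.exists_norm_sq_add_energyForm_eq
  have hsource := WaveEq.two_mul_inner_le hpos hnn hsupp hint (w t).fst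
  have hpotential := WaveEq.weightedForm_fst_le_energyForm V (w t)
  linarith [hw t ht]

theorem theorem1p2 :
    ∃ C : ℝ, 0 < C ∧
      ∀ (n : ℕ), 1 ≤ n →
      ∀ (Ω : Set (WaveEq.Rn n)), IsOpen Ω →
      ∀ (V : WaveEq.Rn n →ᵇ ℝ), (∀ x ∈ Ω, 0 < V x) → (∀ x, 0 ≤ V x) →
      ∀ (u₀ : WaveEq.H1 n) (u₁ : WaveEq.L2 n), WaveEq.essSupport u₁ ⊆ Ω →
        IntegrableOn (fun x => |u₁ x| ^ 2 / V x) Ω →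
      ∀ (u : ℝ → WaveEq.H1 n), WaveEq.IsWeakSolution V u₀ u₁ u →
      ∀ t : ℝ, 0 ≤ t →
        ‖WaveEq.toL2 (u t)‖ ≤ C * (‖WaveEq.toL2 u₀‖ + Real.sqrt (∫ x in Ω, |u₁ x| ^ 2 / V x)) := by
  refine ⟨1, one_pos, fun n _ Ω _ V hpos hnn u₀ u₁ hsupp hint u hu t ht => ?_⟩
  simpa only [one_mul] using WaveEq.le_add_sqrt_of_sq_le (norm_nonneg _)
    (theorem1p2_general hpos hnn hsupp hint hu ht)
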